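/- Let $E$ be a Banach space over $\mathbb{K}=\mathbb{R}$ or $\mathbb{C}$, with dual $E'$ and bidual $E''$, and let $n$ be a non-negative integer. Let $\widehat{\bigotimes}_{n,s,\epsilon}E'$ be the completed $n$-fold symmetric injective tensor product of $E'$, i.e. the completion of the space of symmetric $n$-tensors over $E'$ with respect to the norm $\|t\|_\epsilon=\sup\{|\langle x''\otimes\cdots\otimes x'',t\rangle| : x''\in E'',\ \|x''\|\le 1\}$. Each element $P$ of this space is identified with an $n$-homogeneous polynomial on $E$ (the tensor $\phi\otimes\cdots\otimes\phi$ being the polynomial $x\mapsto\phi(x)^n$), and this polynomial has a unique extension $\tilde P\colon E''\to\mathbb{K}$ whose restriction to every bounded subset of $E''$ is $\sigma(E'',E')$-continuous. Then a bounded sequence $(P_j)_j$ in $\widehat{\bigotimes}_{n,s,\epsilon}E'$ converges weakly to $0$ if and only if $\tilde P_j(x'')\to 0$ as $j\to\infty$ for every $x''\in E''$. -/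

import Mathlib

open Filter Topology
open scoped TensorProduct

noncomputable section

/-! ### Symmetric tensors and the injective norm -/

section SymmetricTensors

variable (𝕜 : Type*) [RCLike 𝕜] (n : ℕ) (F : Type*) [NormedAddCommGroup F] [NormedSpace 𝕜 F]

/-- The subspace of symmetric tensors of the `n`-fold algebraic tensor power of `F`: the tensors
invariant under all permutations of the factors. -/
def symmetricTensors : Submodule 𝕜 (⨂[𝕜] _ : Fin n, F) where
  carrier := {t | ∀ σ : Equiv.Perm (Fin n), PiTensorProduct.reindex 𝕜 (fun _ => F) σ t = t}
  zero_mem' := fun σ => map_zero _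
  add_mem' := fun hs ht σ => (map_add _ _ _).trans (by rw [hs σ, ht σ])
  smul_mem' := fun c t ht σ => (map_smul _ c t).trans (by rw [ht σ])

/-- The space of symmetric `n`-tensors over `F`. It is a type synonym, so that it carries the
injective norm defined below and not the norm that Mathlib puts on a tensor power. -/
def SymTensor : Type _ := symmetricTensors 𝕜 n F

instance : AddCommGroup (SymTensor 𝕜 n F) :=
  inferInstanceAs (AddCommGroup (symmetricTensors 𝕜 n F))

instance : Module 𝕜 (SymTensor 𝕜 n F) :=
  inferInstanceAs (Module 𝕜 (symmetricTensors 𝕜 n F))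

/-- The inclusion of the symmetric tensors into the tensor power. -/
def SymTensor.incl : SymTensor 𝕜 n F →ₗ[𝕜] (⨂[𝕜] _ : Fin n, F) :=
  (symmetricTensors 𝕜 n F).subtype

variable {𝕜 F}

/-- The `n`-th tensor power `f ⊗ ⋯ ⊗ f` of a functional `f`, as a functional on the tensor power
of `F`: it maps `φ₁ ⊗ ⋯ ⊗ φₙ` to `f φ₁ ⋯ f φₙ`. -/
def tensorEval (f : StrongDual 𝕜 F) : (⨂[𝕜] _ : Fin n, F) →ₗ[𝕜] 𝕜 :=
  PiTensorProduct.lift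
    ((MultilinearMap.mkPiAlgebra 𝕜 (Fin n) 𝕜).compLinearMap fun _ => f.toLinearMap)

variable {n}

@[simp]
theorem tensorEval_tprod (f : StrongDual 𝕜 F) (φ : Fin n → F) :
    tensorEval n f (PiTensorProduct.tprod 𝕜 φ) = ∏ i, f (φ i) := by
  simp [tensorEval]

theorem tensorEval_smul (c : 𝕜) (f : StrongDual 𝕜 F) (t : ⨂[𝕜] _ : Fin n, F) :
    tensorEval n (c • f) t = c ^ n * tensorEval n f t := by
  induction t using PiTensorProduct.induction_on with
  | smul_tprod r φ =>
    simp only [map_smul, tensorEval_tprod, smul_apply, smul_eq_mul,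
      Finset.prod_mul_distrib, Finset.prod_const, Finset.card_univ, Fintype.card_fin]
    ring
  | add x y hx hy => rw [map_add, hx, hy, map_add, mul_add]

theorem exists_tensorEval_bound (t : ⨂[𝕜] _ : Fin n, F) :
    ∃ C : ℝ, ∀ f : StrongDual 𝕜 F, ‖f‖ ≤ 1 → ‖tensorEval n f t‖ ≤ C := by
  induction t using PiTensorProduct.induction_on with
  | smul_tprod r φ =>
    refine ⟨‖r‖ * ∏ i, ‖φ i‖, fun f hf => ?_⟩
    rw [map_smul, tensorEval_tprod, norm_smul, norm_prod]
    gcongr with i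
    exact (f.le_opNorm _).trans (mul_le_of_le_one_left (norm_nonneg _) hf)
  | add x y hx hy =>
    obtain ⟨C, hC⟩ := hx
    obtain ⟨D, hD⟩ := hy
    refine ⟨C + D, fun f hf => ?_⟩
    rw [map_add]
    exact (norm_add_le _ _).trans (add_le_add (hC f hf) (hD f hf))

theorem bddAbove_tensorEval (t : ⨂[𝕜] _ : Fin n, F) :
    BddAbove (Set.range fun f : Metric.closedBall (0 : StrongDual 𝕜 F) 1 =>
      ‖tensorEval n f.1 t‖) := by
  obtain ⟨C, hC⟩ := exists_tensorEval_bound t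
  refine ⟨C, ?_⟩
  rintro _ ⟨f, rfl⟩
  exact hC f.1 (mem_closedBall_zero_iff.1 f.2)

instance : Nonempty (Metric.closedBall (0 : StrongDual 𝕜 F) 1) := ⟨⟨0, by simp⟩⟩

variable (𝕜 n F) in
/-- The (symmetric) injective norm of a symmetric tensor: the supremum of the values
`|(f ⊗ ⋯ ⊗ f)(t)|` over the closed unit ball of the dual of `F`. -/
def injectiveSymSeminorm : Seminorm 𝕜 (SymTensor 𝕜 n F) :=
  Seminorm.of
    (fun t => ⨆ f : Metric.closedBall (0 : StrongDual 𝕜 F) 1,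
      ‖tensorEval n f.1 (SymTensor.incl 𝕜 n F t)‖)
    (fun s t => ciSup_le fun f => by
      rw [map_add, map_add]
      exact (norm_add_le _ _).trans
        (add_le_add (le_ciSup (bddAbove_tensorEval _) f) (le_ciSup (bddAbove_tensorEval _) f)))
    (fun c t => by
      simp only [map_smul, norm_smul]
      exact (Real.mul_iSup_of_nonneg (norm_nonneg c) _).symm)

variable (𝕜 n F) in
/-- The symmetric tensors with the injective norm. -/
instance : SeminormedAddCommGroup (SymTensor 𝕜 n F) :=
  AddGroupSeminorm.toSeminormedAddCommGroup (injectiveSymSeminorm 𝕜 n F).toAddGroupSeminorm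

instance : NormedSpace 𝕜 (SymTensor 𝕜 n F) :=
  ⟨fun c t => ((injectiveSymSeminorm 𝕜 n F).smul' c t).le⟩

theorem SymTensor.norm_def (t : SymTensor 𝕜 n F) :
    ‖t‖ = ⨆ f : Metric.closedBall (0 : StrongDual 𝕜 F) 1,
      ‖tensorEval n f.1 (SymTensor.incl 𝕜 n F t)‖ := rfl

theorem SymTensor.norm_tensorEval_le (f : StrongDual 𝕜 F) (t : SymTensor 𝕜 n F) :
    ‖tensorEval n f (SymTensor.incl 𝕜 n F t)‖ ≤ ‖f‖ ^ n * ‖t‖ := by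
  have key : ∀ g : StrongDual 𝕜 F, ‖g‖ ≤ 1 →
      ‖tensorEval n g (SymTensor.incl 𝕜 n F t)‖ ≤ ‖t‖ := fun g hg => by
    rw [SymTensor.norm_def]
    exact le_ciSup (bddAbove_tensorEval (SymTensor.incl 𝕜 n F t))
      (⟨g, mem_closedBall_zero_iff.2 hg⟩ : Metric.closedBall (0 : StrongDual 𝕜 F) 1)
  have hf : f = (‖f‖ : 𝕜) • ((‖f‖ : 𝕜)⁻¹ • f) := by
    by_cases h : f = 0
    · subst h; ext φ; simp
    · rw [smul_inv_smul₀]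
      simpa using h
  have hg : ‖(‖f‖ : 𝕜)⁻¹ • f‖ ≤ 1 := by
    rw [norm_smul, norm_inv, RCLike.norm_ofReal, abs_norm]
    exact inv_mul_le_one
  calc ‖tensorEval n f (SymTensor.incl 𝕜 n F t)‖
      = ‖f‖ ^ n * ‖tensorEval n ((‖f‖ : 𝕜)⁻¹ • f) (SymTensor.incl 𝕜 n F t)‖ := by
        conv_lhs => rw [hf, tensorEval_smul]
        rw [norm_mul, norm_pow, RCLike.norm_ofReal, abs_norm]
    _ ≤ _ := by gcongr; exact key _ hg

variable (𝕜 n F) in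
/-- The completed `n`-fold symmetric injective tensor product of `F`. -/
abbrev InjSymTensor : Type _ := UniformSpace.Completion (SymTensor 𝕜 n F)

/-- The functional `f ⊗ ⋯ ⊗ f` on the symmetric tensors with the injective norm. -/
def SymTensor.evalL (n : ℕ) (f : StrongDual 𝕜 F) : StrongDual 𝕜 (SymTensor 𝕜 n F) :=
  ((tensorEval n f).comp (SymTensor.incl 𝕜 n F)).mkContinuous (‖f‖ ^ n)
    (SymTensor.norm_tensorEval_le f)

/-- The functional `f ⊗ ⋯ ⊗ f` on the completed symmetric injective tensor product. -/
def InjSymTensor.evalL (n : ℕ) (f : StrongDual 𝕜 F) : StrongDual 𝕜 (InjSymTensor 𝕜 n F) :=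
  (SymTensor.evalL n f).extend UniformSpace.Completion.toComplL

theorem InjSymTensor.evalL_coe (f : StrongDual 𝕜 F) (t : SymTensor 𝕜 n F) :
    InjSymTensor.evalL n f (t : InjSymTensor 𝕜 n F) =
      tensorEval n f (SymTensor.incl 𝕜 n F t) :=
  ContinuousLinearMap.extend_eq (e := UniformSpace.Completion.toComplL (𝕜 := 𝕜))
    (SymTensor.evalL n f) UniformSpace.Completion.denseRange_coe
    (UniformSpace.Completion.isUniformInducing_coe _) t

theorem InjSymTensor.norm_evalL_le (f : StrongDual 𝕜 F) (P : InjSymTensor 𝕜 n F) :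
    ‖InjSymTensor.evalL n f P‖ ≤ ‖f‖ ^ n * ‖P‖ := by
  induction P using UniformSpace.Completion.induction_on with
  | hp => exact isClosed_le (by fun_prop) (by fun_prop)
  | ih t =>
    rw [InjSymTensor.evalL_coe, UniformSpace.Completion.norm_coe]
    exact SymTensor.norm_tensorEval_le f t

end SymmetricTensors

/-! ### The polynomial on `E` given by an element of the tensor product over `E'`,
and its extension to `E''` -/

section Extension

variable {𝕜 : Type*} [RCLike 𝕜] {n : ℕ} {E : Type*} [NormedAddCommGroup E] [NormedSpace 𝕜 E]

/-- The `n`-homogeneous polynomial on `E` which an element of the completed symmetric injective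
tensor product of `E'` represents: the symmetric tensor `φ ⊗ ⋯ ⊗ φ` represents `x ↦ φ x ^ n`, and
an element of the completion represents the limit of the polynomials of approximating tensors. -/
def InjSymTensor.toPolynomial (P : InjSymTensor 𝕜 n (StrongDual 𝕜 E)) (x : E) : 𝕜 :=
  InjSymTensor.evalL n (NormedSpace.inclusionInDoubleDual 𝕜 E x) P

/-- `q` extends the function `p` from `E` to `E''`, where `E` is embedded in `E''` canonically, and
`q` is `σ(E'', E')`-continuous on bounded subsets of `E''`. -/
structure IsBidualExtension (p : E → 𝕜) (q : StrongDual 𝕜 (StrongDual 𝕜 E) → 𝕜) : Prop where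
  extends_apply : ∀ x : E, q (NormedSpace.inclusionInDoubleDual 𝕜 E x) = p x
  continuousOn : ∀ r : ℝ,
    ContinuousOn (fun z : WeakDual 𝕜 (StrongDual 𝕜 E) => q (WeakDual.toStrongDual z))
      (WeakDual.toStrongDual ⁻¹' Metric.closedBall 0 r)

theorem continuous_tensorEval_weakDual {F : Type*} [NormedAddCommGroup F] [NormedSpace 𝕜 F]
    (t : ⨂[𝕜] _ : Fin n, F) :
    Continuous fun z : WeakDual 𝕜 F => tensorEval n (WeakDual.toStrongDual z) t := by
  induction t using PiTensorProduct.induction_on with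
  | smul_tprod r φ =>
    simp only [map_smul, tensorEval_tprod, WeakDual.toStrongDual_apply]
    exact (continuous_finsetProd _ fun i _ => WeakDual.eval_continuous (φ i)).const_smul r
  | add x y hx hy =>
    simp only [map_add]
    exact hx.add hy

theorem isBidualExtension_evalL (P : InjSymTensor 𝕜 n (StrongDual 𝕜 E)) :
    IsBidualExtension P.toPolynomial fun z => InjSymTensor.evalL n z P := by
  refine ⟨fun x => rfl, fun r => continuousOn_of_uniform_approx_of_continuousOn fun u hu => ?_⟩
  obtain ⟨ε, hε, hu⟩ := Metric.mem_uniformity_dist.1 hu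
  have hr : (0 : ℝ) < |r| ^ n + 1 := by positivity
  obtain ⟨t, ht⟩ := (UniformSpace.Completion.denseRange_coe (α :=
    SymTensor 𝕜 n (StrongDual 𝕜 E))).exists_dist_lt P (div_pos hε hr)
  refine ⟨fun z => InjSymTensor.evalL n (WeakDual.toStrongDual z) t, ?_, fun z hz => hu ?_⟩
  · simp only [InjSymTensor.evalL_coe]
    exact (continuous_tensorEval_weakDual _).continuousOn
  · rw [dist_eq_norm] at ht ⊢
    rw [← map_sub]
    have hz' : ‖(WeakDual.toStrongDual z : StrongDual 𝕜 (StrongDual 𝕜 E))‖ ≤ |r| :=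
      ((mem_closedBall_zero_iff (E := StrongDual 𝕜 (StrongDual 𝕜 E))).1 hz).trans
        (le_abs_self r)
    calc _ ≤ ‖WeakDual.toStrongDual z‖ ^ n * ‖P - t‖ := InjSymTensor.norm_evalL_le _ _
      _ ≤ (|r| ^ n + 1) * ‖P - t‖ := by
        have := pow_le_pow_left₀ (ContinuousLinearMap.opNorm_nonneg _) hz' n
        gcongr
        linarith
      _ < (|r| ^ n + 1) * (ε / (|r| ^ n + 1)) := by gcongr
      _ = ε := by field_simp

theorem WeakBilin.exists_separating {𝕜 X Y : Type*} [RCLike 𝕜] [AddCommGroup X] [Module 𝕜 X]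
    [Module ℝ X] [IsScalarTower ℝ 𝕜 X] [AddCommGroup Y] [Module 𝕜 Y] (B : X →ₗ[𝕜] Y →ₗ[𝕜] 𝕜)
    {s : Set X} (hs : Convex ℝ s) {z : X} (hz : z ∉ @closure (WeakBilin B) _ s) :
    ∃ (y : Y) (u : ℝ), (∀ w ∈ s, RCLike.re (B w y) < u) ∧ u < RCLike.re (B z y) := by
  have : ContinuousSMul ℝ (WeakBilin B) := IsScalarTower.continuousSMul (M := ℝ) 𝕜
  have hs' : @Convex ℝ (WeakBilin B) _ _ _ _ s := hs
  obtain ⟨f, u, hu, huz⟩ := RCLike.geometric_hahn_banach_closed_point (𝕜 := 𝕜)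
    hs'.closure isClosed_closure hz
  obtain ⟨y, rfl⟩ := LinearMap.dualEmbedding_surjective B f
  exact ⟨y, u, fun w hw => hu w (subset_closure hw), huz⟩

theorem WeakDual.exists_separating {𝕜 F : Type*} [RCLike 𝕜] [NormedAddCommGroup F]
    [NormedSpace 𝕜 F] {s : Set (WeakDual 𝕜 F)} (hs : Convex ℝ s) {z : WeakDual 𝕜 F}
    (hz : z ∉ closure s) :
    ∃ (φ : F) (u : ℝ), (∀ w ∈ s, RCLike.re (w φ) < u) ∧ u < RCLike.re (z φ) :=
  WeakBilin.exists_separating (topDualPairing 𝕜 F) (s := s) (z := z) hs hz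

/-- The canonical map from `E` to `E''` with the topology `σ(E'', E')`. -/
def toWeakBidual (x : E) : WeakDual 𝕜 (StrongDual 𝕜 E) :=
  StrongDual.toWeakDual (NormedSpace.inclusionInDoubleDual 𝕜 E x)

theorem toWeakBidual_apply (x : E) (φ : StrongDual 𝕜 E) : (toWeakBidual x) φ = φ x := rfl

theorem convex_image_toWeakBidual (r : ℝ) :
    Convex ℝ (toWeakBidual (𝕜 := 𝕜) '' Metric.closedBall (0 : E) r) := by
  rintro _ ⟨x, hx, rfl⟩ _ ⟨y, hy, rfl⟩ a b ha hb hab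
  rw [mem_closedBall_zero_iff] at hx hy
  refine ⟨(a : 𝕜) • x + (b : 𝕜) • y, ?_, ?_⟩
  · rw [mem_closedBall_zero_iff]
    calc _ ≤ ‖(a : 𝕜) • x‖ + ‖(b : 𝕜) • y‖ := norm_add_le _ _
      _ = a * ‖x‖ + b * ‖y‖ := by
        rw [norm_smul, norm_smul, RCLike.norm_ofReal, RCLike.norm_ofReal, abs_of_nonneg ha,
          abs_of_nonneg hb]
      _ ≤ a * r + b * r := by gcongr
      _ = r := by rw [← add_mul, hab, one_mul]
  · refine DFunLike.ext _ _ fun φ => ?_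
    change φ ((a : 𝕜) • x + (b : 𝕜) • y) = a • φ x + b • φ y
    simp [RCLike.real_smul_eq_coe_mul]

/-- Goldstine's theorem. -/
theorem mem_closure_image_closedBall (r : ℝ) (z : StrongDual 𝕜 (StrongDual 𝕜 E)) (hz : ‖z‖ ≤ r) :
    StrongDual.toWeakDual z ∈ closure (toWeakBidual (𝕜 := 𝕜) '' Metric.closedBall (0 : E) r) := by
  by_contra hcl
  obtain ⟨φ, u, hu, huz⟩ := WeakDual.exists_separating (convex_image_toWeakBidual r) hcl
  have hball : ∀ x ∈ Metric.closedBall (0 : E) r, ‖φ x‖ ≤ u := by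
    intro x hx
    obtain ⟨c, hc, hcx⟩ := RCLike.exists_norm_eq_mul_self (φ x)
    have hm : c • x ∈ Metric.closedBall (0 : E) r := by
      rw [mem_closedBall_zero_iff] at hx ⊢
      rwa [norm_smul, hc, one_mul]
    have := hu _ ⟨c • x, hm, rfl⟩
    rw [toWeakBidual_apply, map_smul, smul_eq_mul, ← hcx, RCLike.ofReal_re] at this
    exact this.le
  have hr0 : 0 ≤ r := (norm_nonneg z).trans hz
  have hu0 : 0 ≤ u := (norm_nonneg _).trans (hball 0 (by simpa using hr0))
  have hzφ : ‖z φ‖ ≤ r * ‖φ‖ := (z.le_opNorm φ).trans (by gcongr)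
  have hre : u < ‖z φ‖ := huz.trans_le (RCLike.re_le_norm _)
  rcases hr0.eq_or_lt with h0 | hr
  · rw [← h0, zero_mul] at hzφ
    linarith
  · have := ContinuousLinearMap.opNorm_bound_of_ball_bound hr u φ hball
    rw [le_div_iff₀ hr] at this
    linarith

theorem IsBidualExtension.unique {p : E → 𝕜} {q₁ q₂ : StrongDual 𝕜 (StrongDual 𝕜 E) → 𝕜}
    (h₁ : IsBidualExtension p q₁) (h₂ : IsBidualExtension p q₂) : q₁ = q₂ := by
  funext z
  have hJ : Set.MapsTo (toWeakBidual (𝕜 := 𝕜) (E := E)) (Metric.closedBall 0 ‖z‖)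
      (WeakDual.toStrongDual ⁻¹' Metric.closedBall (0 : StrongDual 𝕜 (StrongDual 𝕜 E)) ‖z‖) :=
    fun x hx => (mem_closedBall_zero_iff (E := StrongDual 𝕜 (StrongDual 𝕜 E))).2 <|
      (NormedSpace.double_dual_bound 𝕜 E x).trans (mem_closedBall_zero_iff.1 hx)
  have heq : Set.EqOn
      (fun z : WeakDual 𝕜 (StrongDual 𝕜 E) => q₁ (WeakDual.toStrongDual z))
      (fun z : WeakDual 𝕜 (StrongDual 𝕜 E) => q₂ (WeakDual.toStrongDual z))
      (toWeakBidual (𝕜 := 𝕜) '' Metric.closedBall (0 : E) ‖z‖) := by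
    rintro _ ⟨x, -, rfl⟩
    exact (h₁.extends_apply x).trans (h₂.extends_apply x).symm
  exact heq.of_subset_closure (h₁.continuousOn ‖z‖) (h₂.continuousOn ‖z‖) hJ.image_subset
    (fun w hw => mem_closure_image_closedBall ‖z‖ (WeakDual.toStrongDual w)
      ((mem_closedBall_zero_iff (E := StrongDual 𝕜 (StrongDual 𝕜 E))).1 hw))
    (show StrongDual.toWeakDual z ∈ _ from
      (mem_closedBall_zero_iff (E := StrongDual 𝕜 (StrongDual 𝕜 E))).2 le_rfl)

theorem existsUnique_isBidualExtension (P : InjSymTensor 𝕜 n (StrongDual 𝕜 E)) :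
    ∃! q, IsBidualExtension P.toPolynomial q :=
  ⟨_, isBidualExtension_evalL P, fun _ h => h.unique (isBidualExtension_evalL P)⟩

/-- The unique extension of the polynomial represented by `P` to `E''` which is
`σ(E'', E')`-continuous on bounded sets. -/
def InjSymTensor.bidualExtension (P : InjSymTensor 𝕜 n (StrongDual 𝕜 E)) :
    StrongDual 𝕜 (StrongDual 𝕜 E) → 𝕜 :=
  (existsUnique_isBidualExtension P).choose

end Extension

/-- A sequence in a normed space is weakly null if it converges to `0` in the weak topology. -/
def IsWeaklyNull (𝕜 : Type*) [RCLike 𝕜] {X : Type*} [NormedAddCommGroup X] [NormedSpace 𝕜 X]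
    (u : ℕ → X) : Prop :=
  Tendsto (fun j => toWeakSpace 𝕜 X (u j)) atTop (𝓝 0)

end

/-! The closed unit ball `B` of `E''` is weak-star compact. Each `Q` in the tensor product gives a
continuous function `z ↦ evalL n z Q` on `B` whose sup norm controls `‖Q‖`, so the claim reflects
the fact that bounded pointwise null sequences in `C(B)` are weakly null. Instead of extending a
functional `φ` to `C(B)` and representing it by a scalar measure, the proof uses convexity. If `φ (P
j)` does not tend to `0`, the moduli of a subsequence lie in a convex set `C` of real functions,
each dominating some `|Q|` with `ε ≤ re (φ Q)`. Hahn-Banach, Riesz and dominated convergence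
(`Convex.exists_forall_lt_of_tendsto_zero`) give a uniformly small member of `C`, hence a `Q` of
small norm, against the boundedness of `φ`. -/

/-- A convex set of continuous functions on a compact Hausdorff space which contains a bounded
sequence converging pointwise to `0` contains functions that are uniformly less than any given
`η > 0`. -/
theorem Convex.exists_forall_lt_of_tendsto_zero {K : Type*} [TopologicalSpace K] [CompactSpace K]
    [T2Space K] {C : Set C(K, ℝ)} (hC : Convex ℝ C) {g : ℕ → C(K, ℝ)} (hg : ∀ j, g j ∈ C) {M : ℝ}
    (hM : ∀ j x, |g j x| ≤ M) (h0 : ∀ x, Tendsto (fun j => g j x) atTop (𝓝 0)) {η : ℝ}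
    (hη : 0 < η) : ∃ h ∈ C, ∀ x, h x < η := by
  by_contra! hne
  have hU : Convex ℝ {h : C(K, ℝ) | ∀ x, h x < η} := by
    intro h₁ hh₁ h₂ hh₂ a b ha hb hab x
    exact convex_Iio η (hh₁ x) (hh₂ x) ha hb hab
  have hUo : IsOpen {h : C(K, ℝ) | ∀ x, h x < η} := by
    simpa [Set.MapsTo] using
      ContinuousMap.isOpen_setOfPred_mapsTo (X := K) isCompact_univ (isOpen_Iio (a := η))
  have hdisj : Disjoint {h : C(K, ℝ) | ∀ x, h x < η} C := by
    rw [Set.disjoint_left]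
    intro h hh hhC
    obtain ⟨x, hx⟩ := hne h hhC
    exact absurd (hh x) hx.not_gt
  obtain ⟨f, u, hfU, hfC⟩ := geometric_hahn_banach_open hU hUo hC hdisj
  have hu : 0 < u := by
    simpa using hfU 0 (fun x => by simpa using hη)
  have hpos : ∀ h : C(K, ℝ), (∀ x, 0 ≤ h x) → 0 ≤ f h := by
    intro h hh
    by_contra! hlt
    -- A negative multiple of `h ≥ 0` stays below `η`; this one is scaled so that `f` takes the
    -- value `u` on it, while `f < u` on the open set.
    have hmem := hfU ((u / f h) • h) fun x =>
      (mul_nonpos_of_nonpos_of_nonneg (div_neg_of_pos_of_neg hu hlt).le (hh x)).trans_lt hη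
    rw [map_smul, smul_eq_mul, div_mul_cancel₀ _ hlt.ne] at hmem
    exact hmem.false
  -- As `K` is compact, every continuous function has compact support, so Riesz represents all of
  -- `f` by a finite positive measure.
  let Λ : CompactlySupportedContinuousMap K ℝ →ₚ[ℝ] ℝ := PositiveLinearMap.mk₀
    { toFun := fun h => f h.toContinuousMap
      map_add' := fun h₁ h₂ => f.map_add h₁.toContinuousMap h₂.toContinuousMap
      map_smul' := fun c h => f.map_smul c h.toContinuousMap }
    fun h hh => hpos _ hh
  borelize K
  let μ := RealRMK.rieszMeasure Λ
  have hint : ∀ h : C(K, ℝ), ∫ x, h x ∂μ = f h := fun h =>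
    RealRMK.integral_rieszMeasure Λ (CompactlySupportedContinuousMap.continuousMapEquiv h)
  have hlim : Tendsto (fun j => ∫ x, g j x ∂μ) atTop (𝓝 (∫ _, (0 : ℝ) ∂μ)) :=
    MeasureTheory.tendsto_integral_of_dominated_convergence (fun _ => M)
      (fun j => (g j).continuous.aestronglyMeasurable_of_compactSpace)
      (MeasureTheory.integrable_const M)
      (fun j => .of_forall fun x => hM j x) (.of_forall h0)
  simp only [hint, MeasureTheory.integral_zero] at hlim
  exact hu.not_ge (ge_of_tendsto' hlim fun j => hfC _ (hg j))

theorem isWeaklyNull_iff_forall_tendsto {𝕜 X : Type*} [RCLike 𝕜] [NormedAddCommGroup X]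
    [NormedSpace 𝕜 X] {u : ℕ → X} :
    IsWeaklyNull 𝕜 u ↔ ∀ φ : StrongDual 𝕜 X, Tendsto (fun j => φ (u j)) atTop (𝓝 0) := by
  have hinj : Function.Injective (topDualPairing 𝕜 X).flip := by
    intro x y hxy
    refine (SeparatingDual.eq_iff_forall_dual_eq (R := 𝕜)).2 fun φ => ?_
    exact LinearMap.congr_fun hxy φ
  refine (WeakBilin.tendsto_iff_forall_eval_tendsto (topDualPairing 𝕜 X).flip hinj).trans
    (forall_congr' fun φ => ?_)
  change Tendsto (fun j => φ (u j)) atTop (𝓝 (φ 0)) ↔ _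
  rw [map_zero]

section

variable {𝕜 : Type*} [RCLike 𝕜] {n : ℕ}

/-- The powers of unit-ball functionals are norming on symmetric tensors by definition; density
carries this to the completion. An approximation within `δ / 2` is paid for twice. -/
theorem InjSymTensor.norm_le_of_forall_norm_evalL_le {F : Type*} [NormedAddCommGroup F]
    [NormedSpace 𝕜 F] (P : InjSymTensor 𝕜 n F) {C : ℝ}
    (h : ∀ f : StrongDual 𝕜 F, ‖f‖ ≤ 1 → ‖InjSymTensor.evalL n f P‖ ≤ C) : ‖P‖ ≤ C := by
  refine le_of_forall_pos_le_add fun δ hδ => ?_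
  obtain ⟨t, ht⟩ := (UniformSpace.Completion.denseRange_coe (α :=
    SymTensor 𝕜 n F)).exists_dist_lt P (half_pos hδ)
  rw [dist_eq_norm] at ht
  have htC : ‖t‖ ≤ C + δ / 2 := by
    rw [SymTensor.norm_def]
    refine ciSup_le fun f => ?_
    have hf : ‖f.1‖ ≤ 1 := mem_closedBall_zero_iff.1 f.2
    rw [← InjSymTensor.evalL_coe, ← sub_sub_cancel P (t : InjSymTensor 𝕜 n F), map_sub]
    refine (norm_sub_le _ _).trans (add_le_add (h _ hf) ?_)
    refine (InjSymTensor.norm_evalL_le _ _).trans (le_trans ?_ ht.le)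
    exact mul_le_of_le_one_left (norm_nonneg _) (pow_le_one₀ (norm_nonneg _) hf)
  calc ‖P‖ = ‖(P - t) + t‖ := by rw [sub_add_cancel]
    _ ≤ ‖P - t‖ + ‖(t : InjSymTensor 𝕜 n F)‖ := norm_add_le _ _
    _ ≤ δ / 2 + (C + δ / 2) := by
      rw [UniformSpace.Completion.norm_coe]
      exact add_le_add ht.le htC
    _ = C + δ := by ring

theorem InjSymTensor.bidualExtension_eq_evalL {E : Type*} [NormedAddCommGroup E]
    [NormedSpace 𝕜 E] (P : InjSymTensor 𝕜 n (StrongDual 𝕜 E)) :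
    P.bidualExtension = fun z => InjSymTensor.evalL n z P :=
  (existsUnique_isBidualExtension P).choose_spec.1.unique (isBidualExtension_evalL P)

/-- A bounded sequence in the completed symmetric injective tensor product over a dual space is
weakly null as soon as the functionals `z ⊗ ⋯ ⊗ z` tend to `0` along it. -/
theorem InjSymTensor.tendsto_zero_of_forall_evalL {E : Type*} [NormedAddCommGroup E]
    [NormedSpace 𝕜 E] {P : ℕ → InjSymTensor 𝕜 n (StrongDual 𝕜 E)} {M : ℝ}
    (hM : ∀ j, ‖P j‖ ≤ M)
    (h0 : ∀ z : StrongDual 𝕜 (StrongDual 𝕜 E),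
      Tendsto (fun j => InjSymTensor.evalL n z (P j)) atTop (𝓝 0))
    (φ : StrongDual 𝕜 (InjSymTensor 𝕜 n (StrongDual 𝕜 E))) :
    Tendsto (fun j => φ (P j)) atTop (𝓝 0) := by
  by_contra hφ
  rw [Metric.tendsto_atTop] at hφ
  push Not at hφ
  obtain ⟨ε, hε, hφ⟩ := hφ
  -- Along `ψ` the lower bound `ε` holds at every index, so every `g j` below belongs to `C`.
  obtain ⟨ψ, hψ, hψε⟩ := Filter.extraction_of_frequently_atTop (Filter.frequently_atTop.2 hφ)
  let B : Set (WeakDual 𝕜 (StrongDual 𝕜 E)) :=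
    WeakDual.toStrongDual ⁻¹' Metric.closedBall (0 : StrongDual 𝕜 (StrongDual 𝕜 E)) 1
  have hB : ∀ z : B, ‖WeakDual.toStrongDual z.1‖ ≤ 1 := fun z =>
    (mem_closedBall_zero_iff (E := StrongDual 𝕜 (StrongDual 𝕜 E))).1 z.2
  have : CompactSpace B := isCompact_iff_compactSpace.1 (WeakDual.isCompact_closedBall 0 1)
  let g (j : ℕ) : C(B, ℝ) :=
    ⟨fun z => ‖InjSymTensor.evalL n (WeakDual.toStrongDual z.1) (P (ψ j))‖,
      (((isBidualExtension_evalL (P (ψ j))).continuousOn 1).domRestrict).norm⟩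
  -- Domination instead of equality makes `C` convex, since the modulus is only subadditive; the
  -- real part makes the second condition convex.
  let C : Set C(B, ℝ) := {h | ∃ Q : InjSymTensor 𝕜 n (StrongDual 𝕜 E),
    (∀ z : B, ‖InjSymTensor.evalL n (WeakDual.toStrongDual z.1) Q‖ ≤ h z) ∧ ε ≤ RCLike.re (φ Q)}
  have hC : Convex ℝ C := by
    rintro h₁ ⟨Q₁, hQ₁, hε₁⟩ h₂ ⟨Q₂, hQ₂, hε₂⟩ a b ha hb hab
    refine ⟨(a : 𝕜) • Q₁ + (b : 𝕜) • Q₂, fun z => ?_, ?_⟩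
    · rw [map_add, map_smul, map_smul]
      refine (norm_add_le _ _).trans ?_
      rw [norm_smul, norm_smul, RCLike.norm_ofReal, RCLike.norm_ofReal, abs_of_nonneg ha,
        abs_of_nonneg hb]
      exact add_le_add (mul_le_mul_of_nonneg_left (hQ₁ z) ha)
        (mul_le_mul_of_nonneg_left (hQ₂ z) hb)
    · rw [map_add, map_smul, map_smul, smul_eq_mul, smul_eq_mul, map_add, RCLike.re_ofReal_mul,
        RCLike.re_ofReal_mul]
      calc ε = a * ε + b * ε := by rw [← add_mul, hab, one_mul]
        _ ≤ _ := by gcongr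
  have hg : ∀ j, g j ∈ C := by
    intro j
    -- The unimodular factor `c` turns the value of `φ` into its modulus and leaves `g j` unchanged.
    obtain ⟨c, hc, hcφ⟩ := RCLike.exists_norm_eq_mul_self (φ (P (ψ j)))
    refine ⟨c • P (ψ j), fun z => ?_, ?_⟩
    · rw [map_smul, norm_smul, hc, one_mul]
      exact le_rfl
    · rw [map_smul, smul_eq_mul, ← hcφ, RCLike.ofReal_re, ← dist_zero_right]
      exact hψε j
  have hgM : ∀ j z, |g j z| ≤ M := by
    intro j z
    change |‖InjSymTensor.evalL n (WeakDual.toStrongDual z.1) (P (ψ j))‖| ≤ M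
    rw [abs_norm]
    refine (InjSymTensor.norm_evalL_le _ _).trans ?_
    exact (mul_le_of_le_one_left (norm_nonneg _) (pow_le_one₀ (norm_nonneg _) (hB z))).trans
      (hM _)
  have hg0 : ∀ z, Tendsto (fun j => g j z) atTop (𝓝 0) := fun z =>
    tendsto_zero_iff_norm_tendsto_zero.1 ((h0 _).comp hψ.tendsto_atTop)
  -- The `+ 1` covers `φ = 0` and makes the final inequality strict.
  have hη : 0 < ε / (‖φ‖ + 1) := by positivity
  obtain ⟨h, ⟨Q, hQh, hQε⟩, hlt⟩ := hC.exists_forall_lt_of_tendsto_zero hg hgM hg0 hη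
  have hQ : ‖Q‖ ≤ ε / (‖φ‖ + 1) := Q.norm_le_of_forall_norm_evalL_le fun z hz =>
    (hQh ⟨StrongDual.toWeakDual z,
      (mem_closedBall_zero_iff (E := StrongDual 𝕜 (StrongDual 𝕜 E))).2 hz⟩).trans (hlt _).le
  have : ε < ε := calc
    ε ≤ ‖φ Q‖ := hQε.trans (RCLike.re_le_norm _)
    _ ≤ ‖φ‖ * (ε / (‖φ‖ + 1)) := φ.le_of_opNorm_le_of_le le_rfl hQ
    _ < (‖φ‖ + 1) * (ε / (‖φ‖ + 1)) := by gcongr; linarith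
    _ = ε := by field_simp
  exact this.false

end

theorem lemma5 {𝕜 : Type*} [RCLike 𝕜] {E : Type*} [NormedAddCommGroup E] [NormedSpace 𝕜 E]
    [CompleteSpace E] (n : ℕ) (P : ℕ → InjSymTensor 𝕜 n (StrongDual 𝕜 E))
    (hP : Bornology.IsBounded (Set.range P)) :
    IsWeaklyNull 𝕜 P ↔
      ∀ z : StrongDual 𝕜 (StrongDual 𝕜 E),
        Tendsto (fun j => (P j).bidualExtension z) atTop (𝓝 0) := by
  simp only [isWeaklyNull_iff_forall_tendsto, InjSymTensor.bidualExtension_eq_evalL]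
  obtain ⟨M, hM⟩ := hP.exists_norm_le
  -- Forward direction: evaluation at `z` is itself a continuous functional.
  exact ⟨fun h z => h _,
    InjSymTensor.tendsto_zero_of_forall_evalL fun j => hM _ (Set.mem_range_self j)⟩
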